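/- Let $n\in\mathbb N$ and $K>0$. Let $\mathbb S^n$ be the space of real symmetric $n\times n$ matrices with inner product $A\bullet B=\sum_{i,j}A_{ij}B_{ij}$. A function of a symmetric matrix is obtained by applying it to the eigenvalues, with the convention $0\log 0=0$. Let $\|A\|_{\mathrm{nuc}}$ be the nuclear norm (the sum of the singular values of $A$), let $\|A\|_{\mathrm{op}}$ be the operator norm (the largest singular value), and put $$\Phi(X)=X\bullet\log X-\operatorname{Tr}X,\qquad \mathcal D=\{X\in\mathbb S^n: X\succeq 0,\ \operatorname{Tr}X\le K\}.$$ Strong convexity: $\Phi$ is $\frac1{4K}$-strongly convex on $\mathcal D$ with respect to the nuclear norm, that is, $\mathcal D$ is convex and for all $X,Y\in\mathcal D$ and $a,b\ge 0$ with $a+b=1$, $$\Phi(aX+bY)\le a\,\Phi(X)+b\,\Phi(Y)-ab\cdot\frac{1}{8K}\,\|X-Y\|_{\mathrm{nuc}}^2 .$$ Moreover, define $\Psi:\mathbb S^n\to\mathbb R$ by $$\Psi(Y)=\begin{cases}\operatorname{Tr}\exp Y & \text{if }\operatorname{Tr}\exp Y\le 2K,\\ 2K\log(\operatorname{Tr}\exp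 Y)-2K\log(2K)+2K & \text{otherwise.}\end{cases}$$ Then $\Psi$ is $4K$-smooth in the operator norm, that is, $\Psi$ is continuously differentiable and $\|D\Psi(Y)-D\Psi(Z)\|_{*}\le 4K\,\|Y-Z\|_{\mathrm{op}}$ for all $Y,Z\in\mathbb S^n$, where $\|\cdot\|_*$ is the norm on linear functionals on $\mathbb S^n$ dual to $\|\cdot\|_{\mathrm{op}}$; and the convex conjugate of $\Psi$ agrees with $\Phi$ on $\mathcal D$: for every $X\in\mathcal D$, $$\Psi^*(X)=\sup_{Y\in\mathbb S^n}\bigl(X\bullet Y-\Psi(Y)\bigr)=\Phi(X).$$ -/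

import Mathlib

open scoped Matrix.Norms.L2Operator

noncomputable section

/-- Real symmetric `n × n` matrices, as a real vector space. Its norm is the operator (spectral)
norm of matrices. -/
abbrev SymMat (n : ℕ) : Type :=
  selfAdjoint.submodule ℝ (Matrix (Fin n) (Fin n) ℝ)

/-- The inner product `A • B = ∑ i j, A i j * B i j = Tr (Aᵀ B)`. -/
def frobInner {n : ℕ} (A B : Matrix (Fin n) (Fin n) ℝ) : ℝ :=
  (A.transpose * B).trace

/-- The nuclear norm: the sum of the singular values. -/
def nuclearNorm {n : ℕ} (A : Matrix (Fin n) (Fin n) ℝ) : ℝ :=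
  ∑ i ∈ Finset.range n, (Matrix.toEuclideanLin A).singularValues i

/-- `f` is `m`-strongly convex on `s` with respect to the norm `N`. -/
def StrongConvexOnWrt {E : Type*} [AddCommGroup E] [Module ℝ E]
    (N : E → ℝ) (s : Set E) (m : ℝ) (f : E → ℝ) : Prop :=
  Convex ℝ s ∧ ∀ x ∈ s, ∀ y ∈ s, ∀ a b : ℝ, 0 ≤ a → 0 ≤ b → a + b = 1 →
    f (a • x + b • y) ≤ a * f x + b * f y - a * b * (m / 2 * N (x - y) ^ 2)

/-- `f` is `L`-smooth in the norm of `E`: it is continuously differentiable and its derivative is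
`L`-Lipschitz from the norm of `E` to the dual norm. -/
def SmoothInNorm {E : Type*} [NormedAddCommGroup E] [NormedSpace ℝ E]
    (L : ℝ) (f : E → ℝ) : Prop :=
  ContDiff ℝ 1 f ∧ ∀ x y : E, ‖fderiv ℝ f x - fderiv ℝ f y‖ ≤ L * ‖x - y‖

/-- The convex conjugate `f* (X) = sup_Y (X • Y - f Y)` on symmetric matrices,
with values in the extended reals. -/
def conjugate {n : ℕ} (f : SymMat n → ℝ) (X : SymMat n) : EReal :=
  ⨆ Y : SymMat n, ((frobInner (X : Matrix (Fin n) (Fin n) ℝ) Y - f Y : ℝ) : EReal)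

/-- The mirror map `Φ X = X • log X - Tr X`. The matrix `log X` is obtained by applying `log` to the
eigenvalues; `Real.log 0 = 0` gives the usual convention `0 log 0 = 0` for singular `X`. -/
def mirrorMap {n : ℕ} (X : SymMat n) : ℝ :=
  frobInner (X : Matrix (Fin n) (Fin n) ℝ) (cfc Real.log (X : Matrix (Fin n) (Fin n) ℝ))
    - (X : Matrix (Fin n) (Fin n) ℝ).trace

/-- `{X : X ⪰ 0, Tr X ≤ K}`. -/
def psdTraceLE (n : ℕ) (K : ℝ) : Set (SymMat n) :=
  {X | (X : Matrix (Fin n) (Fin n) ℝ).PosSemidef ∧ (X : Matrix (Fin n) (Fin n) ℝ).trace ≤ K}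

/-- `Tr exp Y`. -/
def traceExp {n : ℕ} (Y : SymMat n) : ℝ :=
  (cfc Real.exp (Y : Matrix (Fin n) (Fin n) ℝ)).trace

/-- `Ψ Y = Tr exp Y` if `Tr exp Y ≤ 2K`, and
`Ψ Y = 2K log (Tr exp Y) - 2K log (2K) + 2K` otherwise. -/
def piecewisePotential {n : ℕ} (K : ℝ) (Y : SymMat n) : ℝ :=
  if traceExp Y ≤ 2 * K then traceExp Y
  else 2 * K * Real.log (traceExp Y) - 2 * K * Real.log (2 * K) + 2 * K

end

/-!
The statement is an instance of the duality between smoothness and strong convexity, and every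
ingredient is elementary once traces are expanded in eigenbases.

*Trace inequalities.* For symmetric `A` and `B` with orthonormal eigenbases `u` and `v`, the trace of
`f(A) g(B)` is the average of `f (a i) * g (b j)` against the doubly stochastic weights
`⟪u i, v j⟫ ^ 2` (`Matrix.IsHermitian.trace_cfc_mul_cfc`). Klein's inequality
`X • Y ≤ Φ X + Tr exp Y` for `X ⪰ 0` is therefore Young's inequality `x * y ≤ x log x - x + exp y`,
term by term.

*Conjugacy.* Let `s` be the least `s ≥ 0` with `Tr exp (Y - s) ≤ 2K`. Both branches of the potential
are given by `Ψ Y = Tr exp (Y - s) + 2K s`. Klein's inequality at `Y - s` yields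
`X • Y - Ψ Y ≤ Φ X` whenever `Tr X ≤ 2K`, with equality at `X = exp (Y - s)`. For fixed `X`, the
supremum over `Y` is approached along `Y = log (X + δ)`, as `Ψ ≤ Tr exp`.

*Smoothness.* The equality case makes `exp (Y - s)` a subgradient of `Ψ` at `Y`. In the mixed basis
`u i`, `v j` of eigenvectors of `Y` and `Z`, the entries of `exp Y - exp Z` are
`(exp (y i) - exp (z j)) * ⟪u i, v j⟫`, so `|exp a - exp b| ≤ (exp a + exp b) / 2 * |a - b|` and
Cauchy–Schwarz bound the trace norm of `exp Y - exp Z` by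
`(Tr exp Y + Tr exp Z) / 2 * ‖Y - Z‖` (`Matrix.abs_trace_cfc_exp_sub_mul_le`). Since `s` is
`1`-Lipschitz in `Y` and the traces involved are at most `2K`, the subgradient is `4K`-Lipschitz; a
Lipschitz selection of subgradients is the derivative (`hasFDerivAt_of_subgradient`), so no derivative
of a matrix function has to be computed.

*Strong convexity.* The descent lemma for `Ψ`, applied in the direction `sign (X - Y)`, at which the
nuclear norm is attained, transfers to its conjugate
(`SmoothInNorm.strongConvexOnWrt_conjugate`).
-/

open scoped Matrix

/-! ### Spectral calculus of real symmetric matrices -/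

namespace Matrix.IsHermitian

variable {ι : Type*} [Fintype ι] [DecidableEq ι] {A B : Matrix ι ι ℝ}

/-- The functional calculus, written out in an orthonormal eigenbasis. -/
lemma cfc_eq_conj_diagonal (hA : A.IsHermitian) (f : ℝ → ℝ) :
    cfc f A = (hA.eigenvectorUnitary : Matrix ι ι ℝ) * diagonal (fun i => f (hA.eigenvalues i)) *
      star (hA.eigenvectorUnitary : Matrix ι ι ℝ) := by
  rw [hA.cfc_eq, IsHermitian.cfc, Unitary.conjStarAlgAut_apply]
  rfl

lemma eq_conj_diagonal (hA : A.IsHermitian) :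
    A = (hA.eigenvectorUnitary : Matrix ι ι ℝ) * diagonal hA.eigenvalues *
      star (hA.eigenvectorUnitary : Matrix ι ι ℝ) := by
  conv_lhs => rw [hA.spectral_theorem, Unitary.conjStarAlgAut_apply]
  rfl

lemma cfc_isHermitian (f : ℝ → ℝ) (A : Matrix ι ι ℝ) : (cfc f A).IsHermitian :=
  cfc_predicate f A

/-- The squared coefficients `⟪u i, v j⟫ ^ 2` comparing the chosen orthonormal eigenbases `u` of `A`
and `v` of `B`; they form a doubly stochastic matrix. -/
noncomputable def overlap (hA : A.IsHermitian) (hB : B.IsHermitian) (i j : ι) : ℝ :=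
  ((star (hA.eigenvectorUnitary : Matrix ι ι ℝ) * (hB.eigenvectorUnitary : Matrix ι ι ℝ)) i j) ^ 2

lemma overlap_nonneg (hA : A.IsHermitian) (hB : B.IsHermitian) (i j : ι) :
    0 ≤ overlap hA hB i j := sq_nonneg _

lemma sum_overlap_right (hA : A.IsHermitian) (hB : B.IsHermitian) (i : ι) :
    ∑ j, overlap hA hB i j = 1 := by
  have h : (star (hA.eigenvectorUnitary : Matrix ι ι ℝ) * (hB.eigenvectorUnitary : Matrix ι ι ℝ)) *
      star (star (hA.eigenvectorUnitary : Matrix ι ι ℝ) *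
        (hB.eigenvectorUnitary : Matrix ι ι ℝ)) = 1 := by
    rw [star_mul, star_star, mul_assoc, ← mul_assoc _ (star _),
      Unitary.mul_star_self_of_mem (SetLike.coe_mem _), one_mul, Unitary.coe_star_mul_self]
  have := congrFun (congrFun h i) i
  rw [mul_apply, one_apply_eq] at this
  rw [← this]
  exact Finset.sum_congr rfl fun j _ => by rw [overlap, sq, star_apply, star_trivial (R := ℝ)]

lemma overlap_comm (hA : A.IsHermitian) (hB : B.IsHermitian) (i j : ι) :
    overlap hA hB i j = overlap hB hA j i := by
  have h : star (hB.eigenvectorUnitary : Matrix ι ι ℝ) * (hA.eigenvectorUnitary : Matrix ι ι ℝ) =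
      star (star (hA.eigenvectorUnitary : Matrix ι ι ℝ) *
        (hB.eigenvectorUnitary : Matrix ι ι ℝ)) := by simp
  rw [overlap, overlap, h, star_apply, star_trivial (R := ℝ)]

lemma sum_overlap_left (hA : A.IsHermitian) (hB : B.IsHermitian) (j : ι) :
    ∑ i, overlap hA hB i j = 1 := by
  simp_rw [overlap_comm hA hB]
  exact sum_overlap_right hB hA j

/-- Traces of products of functions of two symmetric matrices are averages, against the doubly
stochastic overlaps of the eigenbases, of the corresponding scalar products. This reduces trace
inequalities in `A` and `B` to scalar inequalities. -/
lemma trace_cfc_mul_cfc (hA : A.IsHermitian) (hB : B.IsHermitian) (f g : ℝ → ℝ) :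
    (cfc f A * cfc g B).trace =
      ∑ i, ∑ j, overlap hA hB i j * (f (hA.eigenvalues i) * g (hB.eigenvalues j)) := by
  set U : Matrix ι ι ℝ := (hA.eigenvectorUnitary : Matrix ι ι ℝ) with hU
  set V : Matrix ι ι ℝ := (hB.eigenvectorUnitary : Matrix ι ι ℝ) with hV
  have h : (cfc f A * cfc g B).trace =
      (diagonal (fun i => f (hA.eigenvalues i)) * (star U * V) *
        (diagonal (fun i => g (hB.eigenvalues i)) * star (star U * V))).trace := by
    rw [hA.cfc_eq_conj_diagonal, hB.cfc_eq_conj_diagonal, ← hU, ← hV, mul_assoc, mul_assoc,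
      trace_mul_comm, star_mul, star_star]
    simp only [mul_assoc]
  rw [h, trace]
  refine Finset.sum_congr rfl fun i _ => ?_
  rw [diag_apply, mul_apply]
  refine Finset.sum_congr rfl fun j _ => ?_
  rw [diagonal_mul, diagonal_mul, star_apply, star_trivial (R := ℝ), overlap, ← hU, ← hV]
  ring

lemma cfc_id_eq (hA : A.IsHermitian) : cfc (fun x : ℝ => x) A = A := cfc_id' ℝ A hA

lemma trace_cfc (hA : A.IsHermitian) (f : ℝ → ℝ) :
    (cfc f A).trace = ∑ i, f (hA.eigenvalues i) := by
  rw [hA.cfc_eq_conj_diagonal, mul_assoc, trace_mul_comm, mul_assoc, Unitary.coe_star_mul_self,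
    mul_one, trace_diagonal]

lemma trace_mul_cfc (hA : A.IsHermitian) (g : ℝ → ℝ) :
    (A * cfc g A).trace = ∑ i, hA.eigenvalues i * g (hA.eigenvalues i) := by
  have h : A * cfc g A = (hA.eigenvectorUnitary : Matrix ι ι ℝ) *
      diagonal (fun i => hA.eigenvalues i * g (hA.eigenvalues i)) *
      star (hA.eigenvectorUnitary : Matrix ι ι ℝ) := by
    nth_rewrite 1 [hA.eq_conj_diagonal]
    rw [hA.cfc_eq_conj_diagonal, ← diagonal_mul_diagonal]
    simp only [mul_assoc]
    rw [← mul_assoc (star _) (hA.eigenvectorUnitary : Matrix ι ι ℝ), Unitary.coe_star_mul_self,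
      one_mul]
  rw [h, mul_assoc, trace_mul_comm, mul_assoc, Unitary.coe_star_mul_self, mul_one, trace_diagonal]

lemma norm_cfc_eq (hA : A.IsHermitian) (f : ℝ → ℝ) :
    ‖cfc f A‖ = ‖fun i => f (hA.eigenvalues i)‖ := by
  rw [hA.cfc_eq_conj_diagonal, ← Unitary.coe_star, CStarRing.norm_mul_coe_unitary,
    CStarRing.norm_coe_unitary_mul, l2_opNorm_diagonal]

lemma abs_eigenvalues_le_norm (hA : A.IsHermitian) (i : ι) : |hA.eigenvalues i| ≤ ‖A‖ := by
  have h := hA.norm_cfc_eq fun x => x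
  rw [hA.cfc_id_eq] at h
  rw [h]
  exact norm_le_pi_norm (fun i => hA.eigenvalues i) i

lemma trace_cfc_mul (hA : A.IsHermitian) (hB : B.IsHermitian) (f : ℝ → ℝ) :
    (cfc f A * B).trace =
      ∑ i, ∑ j, overlap hA hB i j * (f (hA.eigenvalues i) * hB.eigenvalues j) := by
  have := trace_cfc_mul_cfc hA hB f fun x => x
  rwa [hB.cfc_id_eq] at this

lemma trace_mul_eq (hA : A.IsHermitian) (hB : B.IsHermitian) :
    (A * B).trace =
      ∑ i, ∑ j, overlap hA hB i j * (hA.eigenvalues i * hB.eigenvalues j) := by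
  have := trace_cfc_mul hA hB fun x => x
  rwa [hA.cfc_id_eq] at this

/-- A sum over the eigenvalues of `A`, spread over the eigenvalues of `B` by the overlaps. -/
lemma sum_eigenvalues_eq_sum_overlap_left (hA : A.IsHermitian) (hB : B.IsHermitian) (f : ℝ → ℝ) :
    ∑ i, f (hA.eigenvalues i) = ∑ i, ∑ j, overlap hA hB i j * f (hA.eigenvalues i) := by
  simp_rw [← Finset.sum_mul, sum_overlap_right, one_mul]

lemma sum_eigenvalues_eq_sum_overlap_right (hA : A.IsHermitian) (hB : B.IsHermitian)
    (f : ℝ → ℝ) :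
    ∑ j, f (hB.eigenvalues j) = ∑ i, ∑ j, overlap hA hB i j * f (hB.eigenvalues j) := by
  rw [Finset.sum_comm]
  simp_rw [← Finset.sum_mul, sum_overlap_left, one_mul]

/-- Duality of the trace and operator norms against a nonnegative function of a matrix. -/
lemma abs_trace_cfc_mul_le (hA : A.IsHermitian) (hB : B.IsHermitian) {f : ℝ → ℝ}
    (hf : ∀ x, 0 ≤ f x) : |(cfc f A * B).trace| ≤ (cfc f A).trace * ‖B‖ := by
  rw [trace_cfc_mul hA hB, trace_cfc hA, sum_eigenvalues_eq_sum_overlap_left hA hB, Finset.sum_mul]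
  refine (Finset.abs_sum_le_sum_abs _ _).trans (Finset.sum_le_sum fun i _ => ?_)
  rw [Finset.sum_mul]
  refine (Finset.abs_sum_le_sum_abs _ _).trans (Finset.sum_le_sum fun j _ => ?_)
  rw [abs_mul, abs_mul, abs_of_nonneg (overlap_nonneg hA hB i j), abs_of_nonneg (hf _), mul_assoc]
  exact mul_le_mul_of_nonneg_left
    (mul_le_mul_of_nonneg_left (hB.abs_eigenvalues_le_norm j) (hf _)) (overlap_nonneg hA hB i j)

/-- **Klein's inequality** for the entropy: it holds eigenvalue by eigenvalue, where it is Young's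
inequality `x * y ≤ (x * log x - x) + exp y`. -/
lemma trace_mul_le_entropy_add_trace_exp (hA : A.IsHermitian) (hpos : ∀ i, 0 ≤ hA.eigenvalues i)
    (hB : B.IsHermitian) :
    (A * B).trace ≤ (A * cfc Real.log A).trace - A.trace + (cfc Real.exp B).trace := by
  have hyoung : ∀ x y : ℝ, 0 ≤ x → x * y ≤ (x * Real.log x - x) + Real.exp y := by
    intro x y hx
    rcases hx.eq_or_lt with rfl | hx
    · simpa using (Real.exp_pos y).le
    · have h := Real.add_one_le_exp (y - Real.log x)
      rw [Real.exp_sub, Real.exp_log hx, le_div_iff₀ hx] at h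
      linarith
  have htr : (A * cfc Real.log A).trace - A.trace =
      ∑ i, (hA.eigenvalues i * Real.log (hA.eigenvalues i) - hA.eigenvalues i) := by
    have h := hA.trace_cfc fun x => x
    rw [hA.cfc_id_eq] at h
    rw [trace_mul_cfc, h, Finset.sum_sub_distrib]
  rw [htr, trace_mul_eq hA hB, trace_cfc hB,
    sum_eigenvalues_eq_sum_overlap_left hA hB (fun x => x * Real.log x - x),
    sum_eigenvalues_eq_sum_overlap_right hA hB, ← Finset.sum_add_distrib]
  refine Finset.sum_le_sum fun i _ => ?_
  rw [← Finset.sum_add_distrib]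
  refine Finset.sum_le_sum fun j _ => ?_
  rw [← mul_add]
  exact mul_le_mul_of_nonneg_left (hyoung _ _ (hpos i)) (overlap_nonneg hA hB i j)

end Matrix.IsHermitian

/-! ### Lipschitz continuity of the matrix exponential in trace norm -/

/-- The logarithmic mean of `exp a` and `exp b` is at most their arithmetic mean. -/
lemma Real.abs_exp_sub_exp_le (a b : ℝ) :
    |Real.exp a - Real.exp b| ≤ (Real.exp a + Real.exp b) / 2 * |a - b| := by
  have hsinh : ∀ x : ℝ, 0 ≤ x → Real.sinh x ≤ x * Real.cosh x := by
    intro x hx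
    have hmono : MonotoneOn (fun x => x * Real.cosh x - Real.sinh x) (Set.Ici 0) := by
      refine monotoneOn_of_deriv_nonneg (convex_Ici 0) (by fun_prop) (by fun_prop) ?_
      intro y hy
      rw [interior_Ici, Set.mem_Ioi] at hy
      have hd : HasDerivAt (fun x => x * Real.cosh x - Real.sinh x)
          (1 * Real.cosh y + y * Real.sinh y - Real.cosh y) y :=
        ((hasDerivAt_id y).mul (Real.hasDerivAt_cosh y)).sub (Real.hasDerivAt_sinh y)
      rw [hd.deriv]
      have := mul_nonneg hy.le (Real.sinh_nonneg_iff.2 hy.le)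
      linarith
    have := hmono (Set.self_mem_Ici) hx hx
    simp at this
    linarith
  wlog hab : b ≤ a generalizing a b
  · rw [abs_sub_comm, add_comm, abs_sub_comm a]
    exact this b a (le_of_not_ge hab)
  rw [abs_of_nonneg (sub_nonneg.2 (Real.exp_le_exp.2 hab)), abs_of_nonneg (sub_nonneg.2 hab)]
  have h := hsinh ((a - b) / 2) (by linarith)
  rw [Real.sinh_eq, Real.cosh_eq] at h
  have ha : Real.exp a = Real.exp ((a + b) / 2) * Real.exp ((a - b) / 2) := by
    rw [← Real.exp_add]; ring_nf
  have hb : Real.exp b = Real.exp ((a + b) / 2) * Real.exp (-((a - b) / 2)) := by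
    rw [← Real.exp_add]; ring_nf
  rw [ha, hb]
  nlinarith [mul_le_mul_of_nonneg_left h (Real.exp_pos ((a + b) / 2)).le]

namespace Matrix

variable {ι : Type*} [Fintype ι] [DecidableEq ι]

lemma sum_sq_col_le (A : Matrix ι ι ℝ) (j : ι) : ∑ i, A i j ^ 2 ≤ ‖A‖ ^ 2 := by
  have h := A.l2_opNorm_mulVec (EuclideanSpace.single j 1)
  rw [PiLp.norm_single, norm_one, mul_one] at h
  have h2 := pow_le_pow_left₀ (norm_nonneg _) h 2
  rw [EuclideanSpace.norm_sq_eq] at h2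
  simpa using h2

lemma sum_sq_row_le (A : Matrix ι ι ℝ) (i : ι) : ∑ j, A i j ^ 2 ≤ ‖A‖ ^ 2 := by
  have h := sum_sq_col_le Aᴴ i
  rw [l2_opNorm_conjTranspose] at h
  simpa using h

/-- Cauchy–Schwarz for a row of `A` and the corresponding column of `B`. -/
lemma sum_abs_mul_abs_le (A B : Matrix ι ι ℝ) (i : ι) :
    ∑ j, |A i j| * |B j i| ≤ ‖A‖ * ‖B‖ := by
  have h := Finset.sum_mul_sq_le_sq_mul_sq Finset.univ (fun j => |A i j|) (fun j => |B j i|)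
  simp_rw [sq_abs] at h
  refine abs_le_of_sq_le_sq' (h.trans ?_) (by positivity) |>.2
  rw [mul_pow]
  exact mul_le_mul (sum_sq_row_le A i) (sum_sq_col_le B i)
    (Finset.sum_nonneg fun _ _ => sq_nonneg _) (sq_nonneg _)

/-- The matrix exponential is Lipschitz from the operator norm to the trace norm, the latter tested
against an arbitrary matrix `C`. In the mixed basis formed by eigenvectors `u i` of `Y` and `v j` of
`Z`, the difference `exp Y - exp Z` has entries `(exp (y i) - exp (z j)) * ⟪u i, v j⟫`, while those of
`Y - Z` are `(y i - z j) * ⟪u i, v j⟫`. -/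
lemma abs_trace_cfc_exp_sub_mul_le {Y Z : Matrix ι ι ℝ} (hY : Y.IsHermitian) (hZ : Z.IsHermitian)
    (C : Matrix ι ι ℝ) :
    |((cfc Real.exp Y - cfc Real.exp Z) * C).trace| ≤
      ((cfc Real.exp Y).trace + (cfc Real.exp Z).trace) / 2 * (‖Y - Z‖ * ‖C‖) := by
  rw [hY.trace_cfc, hZ.trace_cfc]
  have hYd := hY.eq_conj_diagonal
  have hZd := hZ.eq_conj_diagonal
  rw [hY.cfc_eq_conj_diagonal, hZ.cfc_eq_conj_diagonal]
  set y := hY.eigenvalues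
  set z := hZ.eigenvalues
  set U : Matrix ι ι ℝ := (hY.eigenvectorUnitary : Matrix ι ι ℝ) with hU
  set V : Matrix ι ι ℝ := (hZ.eigenvectorUnitary : Matrix ι ι ℝ) with hV
  have hUU : star U * U = 1 := Unitary.coe_star_mul_self _
  have hVV : star V * V = 1 := Unitary.coe_star_mul_self _
  have hUU' : U * star U = 1 := Unitary.coe_mul_star_self _
  have hVV' : V * star V = 1 := Unitary.coe_mul_star_self _
  -- Entries in the mixed basis.
  have hmix : ∀ p q : ι → ℝ, ∀ i j,
      (star U * (U * diagonal p * star U - V * diagonal q * star V) * V) i j =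
        (p i - q j) * (star U * V) i j := by
    intro p q i j
    have h : star U * (U * diagonal p * star U - V * diagonal q * star V) * V =
        diagonal p * (star U * V) - (star U * V) * diagonal q := by
      calc _ = (star U * U) * diagonal p * (star U * V) -
            (star U * V) * diagonal q * (star V * V) := by noncomm_ring
        _ = _ := by rw [hUU, hVV, one_mul, mul_one]
    rw [h, sub_apply, diagonal_mul, mul_diagonal]
    ring
  set A := star U * (Y - Z) * V with hA
  set B := star V * C * U with hB
  have hAent : ∀ i j, A i j = (y i - z j) * (star U * V) i j := by
    intro i j
    rw [hA, hYd, hZd]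
    exact hmix y z i j
  have hAn : ‖A‖ = ‖Y - Z‖ := by
    rw [hA, hV, CStarRing.norm_mul_coe_unitary, hU, ← Unitary.coe_star,
      CStarRing.norm_coe_unitary_mul]
  have hBn : ‖B‖ = ‖C‖ := by
    rw [hB, hU, CStarRing.norm_mul_coe_unitary, hV, ← Unitary.coe_star,
      CStarRing.norm_coe_unitary_mul]
  set D := U * diagonal (fun i => Real.exp (y i)) * star U -
    V * diagonal (fun i => Real.exp (z i)) * star V with hD
  have htr : (D * C).trace = ∑ i, ∑ j, (star U * D * V) i j * B j i := by
    have h : D * C = D * (V * star V) * (C * (U * star U)) := by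
      rw [hUU', hVV', mul_one, mul_one]
    have h2 : (D * C).trace = ((star U * D * V) * B).trace := by
      rw [h, hB, show D * (V * star V) * (C * (U * star U)) =
        (D * V * star V * C * U) * star U by noncomm_ring, trace_mul_comm]
      congr 1
      noncomm_ring
    rw [h2, trace]
    exact Finset.sum_congr rfl fun i _ => mul_apply
  rw [htr, ← hAn, ← hBn]
  have hterm : ∀ i j, |(star U * D * V) i j * B j i| ≤
      Real.exp (y i) / 2 * (|A i j| * |B j i|) + Real.exp (z j) / 2 * (|B j i| * |A i j|) := by
    intro i j
    rw [hD, hmix, hAent, abs_mul, abs_mul, abs_mul]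
    have h := mul_le_mul_of_nonneg_right (Real.abs_exp_sub_exp_le (y i) (z j))
      (mul_nonneg (abs_nonneg ((star U * V) i j)) (abs_nonneg (B j i)))
    linarith
  calc |∑ i, ∑ j, (star U * D * V) i j * B j i|
      ≤ ∑ i, ∑ j, |(star U * D * V) i j * B j i| :=
        (Finset.abs_sum_le_sum_abs _ _).trans
          (Finset.sum_le_sum fun i _ => Finset.abs_sum_le_sum_abs _ _)
    _ ≤ ∑ i, ∑ j, (Real.exp (y i) / 2 * (|A i j| * |B j i|) +
          Real.exp (z j) / 2 * (|B j i| * |A i j|)) :=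
        Finset.sum_le_sum fun i _ => Finset.sum_le_sum fun j _ => hterm i j
    _ = ∑ i, Real.exp (y i) / 2 * ∑ j, |A i j| * |B j i| +
          ∑ j, Real.exp (z j) / 2 * ∑ i, |B j i| * |A i j| := by
        simp_rw [Finset.sum_add_distrib, Finset.mul_sum]
        congr 1
        exact Finset.sum_comm
    _ ≤ ∑ i, Real.exp (y i) / 2 * (‖A‖ * ‖B‖) + ∑ j, Real.exp (z j) / 2 * (‖B‖ * ‖A‖) :=
        add_le_add
          (Finset.sum_le_sum fun i _ =>
            mul_le_mul_of_nonneg_left (sum_abs_mul_abs_le A B i) (by positivity))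
          (Finset.sum_le_sum fun j _ =>
            mul_le_mul_of_nonneg_left (sum_abs_mul_abs_le B A j) (by positivity))
    _ = _ := by
        rw [← Finset.sum_mul, ← Finset.sum_mul, ← Finset.sum_div, ← Finset.sum_div]
        ring

end Matrix

/-! ### The nuclear norm of a symmetric matrix -/

lemma Matrix.singularValues_toEuclideanLin {ι : Type*} [Fintype ι] [DecidableEq ι]
    (A : Matrix ι ι ℝ) (i : Fin (Fintype.card ι)) :
    (Matrix.toEuclideanLin A).singularValues i =
      √((Matrix.isHermitian_conjTranspose_mul_self A).eigenvalues₀ i) := by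
  have hop : LinearMap.adjoint (Matrix.toEuclideanLin A) ∘ₗ Matrix.toEuclideanLin A =
      Matrix.toEuclideanLin (A.conjTranspose * A) := by
    rw [← Matrix.toEuclideanLin_conjTranspose_eq_adjoint, Matrix.toLpLin_mul_same]
  have hfin : Module.finrank ℝ (EuclideanSpace ℝ ι) = Fintype.card ι := finrank_euclideanSpace
  rw [LinearMap.singularValues_fin _ hfin i, Matrix.IsHermitian.eigenvalues₀]
  simp only [hop]

lemma nuclearNorm_eq_sum_abs_eigenvalues {n : ℕ} {A : Matrix (Fin n) (Fin n) ℝ}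
    (hA : A.IsHermitian) : nuclearNorm A = ∑ i, |hA.eigenvalues i| := by
  have hG : (A.conjTranspose * A).IsHermitian := Matrix.isHermitian_conjTranspose_mul_self A
  -- The eigenvalues of `Aᴴ * A = A ^ 2` are read off its characteristic polynomial.
  have hsq : A.conjTranspose * A = cfc (fun x : ℝ => x ^ 2) A := by
    have h := cfc_pow_id (R := ℝ) A 2 hA
    rw [hA.eq, ← sq]
    exact h.symm
  have hroots : Multiset.map hG.eigenvalues₀ Finset.univ.val =
      Multiset.map (fun i => hA.eigenvalues i ^ 2) Finset.univ.val := by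
    have h1 := hG.roots_charpoly_eq_eigenvalues₀
    have h2 : (A.conjTranspose * A).charpoly.roots =
        Multiset.map (fun i => hA.eigenvalues i ^ 2) Finset.univ.val := by
      rw [hsq, hA.charpoly_cfc_eq, Polynomial.roots_prod]
      · simp [-map_pow]
      · simp [-map_pow, Finset.prod_ne_zero_iff, Polynomial.X_sub_C_ne_zero]
    rw [← h2, h1]
    rfl
  have hsum := congrArg (fun s : Multiset ℝ => (s.map Real.sqrt).sum) hroots
  simp only [Multiset.map_map, Function.comp_def, Real.sqrt_sq_eq_abs] at hsum
  rw [nuclearNorm, ← Finset.sum_map_val Finset.univ, ← hsum]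
  have hc : Fintype.card (Fin n) = n := Fintype.card_fin n
  calc _ = ∑ i ∈ Finset.range (Fintype.card (Fin n)),
        (Matrix.toEuclideanLin A).singularValues i := by rw [hc]
    _ = ∑ i : Fin (Fintype.card (Fin n)), (Matrix.toEuclideanLin A).singularValues i :=
        Finset.sum_range _
    _ = _ := Finset.sum_congr rfl fun i _ => A.singularValues_toEuclideanLin i

/-- The nuclear norm is attained in its duality with the operator norm, at the sign of the matrix. -/
lemma trace_mul_cfc_sign {n : ℕ} {A : Matrix (Fin n) (Fin n) ℝ} (hA : A.IsHermitian) :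
    (A * cfc (fun x : ℝ => (SignType.sign x : ℝ)) A).trace = nuclearNorm A := by
  rw [hA.trace_mul_cfc, nuclearNorm_eq_sum_abs_eigenvalues hA]
  exact Finset.sum_congr rfl fun i _ => self_mul_sign _

lemma norm_cfc_sign_le {n : ℕ} {A : Matrix (Fin n) (Fin n) ℝ} (hA : A.IsHermitian) :
    ‖cfc (fun x : ℝ => (SignType.sign x : ℝ)) A‖ ≤ 1 := by
  rw [hA.norm_cfc_eq, pi_norm_le_iff_of_nonneg zero_le_one]
  intro i
  rcases lt_trichotomy (hA.eigenvalues i) 0 with h | h | h <;> simp [h]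

/-! ### Smoothness and strong convexity in normed spaces -/

section NormedSpace

variable {E : Type*} [NormedAddCommGroup E] [NormedSpace ℝ E]

/-- A Lipschitz selection of subgradients is a derivative: the subgradient inequality at both
endpoints bounds the first-order remainder by `L * ‖y - x‖ ^ 2`. -/
lemma hasFDerivAt_of_subgradient {f : E → ℝ} {G : E → E →L[ℝ] ℝ} {L : ℝ}
    (hsub : ∀ x y, f x + G x (y - x) ≤ f y) (hG : ∀ x y, ‖G x - G y‖ ≤ L * ‖x - y‖) (x : E) :
    HasFDerivAt f (G x) x := by
  have hbound : ∀ y, ‖f y - f x - G x (y - x)‖ ≤ L * ‖y - x‖ ^ 2 := by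
    intro y
    have h1 := hsub x y
    have h2 := hsub y x
    have h3 : (G y - G x) (y - x) ≤ L * ‖y - x‖ ^ 2 := by
      calc (G y - G x) (y - x) ≤ ‖(G y - G x) (y - x)‖ := Real.le_norm_self _
        _ ≤ ‖G y - G x‖ * ‖y - x‖ := ContinuousLinearMap.le_opNorm _ _
        _ ≤ L * ‖y - x‖ * ‖y - x‖ := by gcongr; exact hG y x
        _ = _ := by ring
    have h4 : G y (x - y) = - G y (y - x) := by rw [← map_neg, neg_sub]
    rw [_root_.sub_apply] at h3
    rw [Real.norm_of_nonneg (by linarith)]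
    linarith
  refine HasFDerivAt.of_isLittleO ?_
  refine (Asymptotics.IsBigO.of_bound L (Filter.Eventually.of_forall fun y => ?_) :
    (fun y => f y - f x - G x (y - x)) =O[nhds x] fun y => ‖y - x‖ ^ 2).trans_isLittleO ?_
  · simpa using hbound y
  · refine Asymptotics.isLittleO_norm_right.1 ?_
    have h : Filter.Tendsto (fun y => ‖y - x‖) (nhds x) (nhds 0) := by
      have : Continuous fun y => ‖y - x‖ := by fun_prop
      simpa using this.tendsto x
    exact (Asymptotics.isLittleO_pow_id one_lt_two).comp_tendsto h

lemma smoothInNorm_of_subgradient {f : E → ℝ} {G : E → E →L[ℝ] ℝ} {L : ℝ}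
    (hsub : ∀ x y, f x + G x (y - x) ≤ f y) (hG : ∀ x y, ‖G x - G y‖ ≤ L * ‖x - y‖) :
    SmoothInNorm L f := by
  have hd := hasFDerivAt_of_subgradient hsub hG
  have hfd : fderiv ℝ f = G := funext fun x => (hd x).fderiv
  refine ⟨contDiff_one_iff_fderiv.2 ⟨fun x => (hd x).differentiableAt, ?_⟩, fun x y => ?_⟩
  · rw [hfd]
    refine (LipschitzWith.of_dist_le_mul (K := L.toNNReal) fun x y => ?_).continuous
    rw [dist_eq_norm, dist_eq_norm]
    exact (hG x y).trans
      (mul_le_mul_of_nonneg_right (Real.le_coe_toNNReal L) (norm_nonneg _))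
  · rw [hfd]
    exact hG x y

/-- The descent lemma: a smooth function lies below its quadratic upper model. -/
lemma SmoothInNorm.le_add_fderiv {f : E → ℝ} {L : ℝ} (hf : SmoothInNorm L f) (x h : E) :
    f (x + h) ≤ f x + fderiv ℝ f x h + L / 2 * ‖h‖ ^ 2 := by
  have hdiff : Differentiable ℝ f := hf.1.differentiable one_ne_zero
  set q : ℝ → ℝ := fun t => f (x + t • h) - t * fderiv ℝ f x h - L / 2 * ‖h‖ ^ 2 * t ^ 2 with hq
  have hqd : ∀ t, HasDerivAt q
      (fderiv ℝ f (x + t • h) h - fderiv ℝ f x h - L * ‖h‖ ^ 2 * t) t := by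
    intro t
    have hline : HasDerivAt (fun t : ℝ => x + t • h) h t := by
      simpa using ((hasDerivAt_id t).smul_const h).const_add x
    have h1 : HasDerivAt (fun t : ℝ => f (x + t • h)) (fderiv ℝ f (x + t • h) h) t :=
      (hdiff (x + t • h)).hasFDerivAt.comp_hasDerivAt t hline
    have h2 := (h1.sub ((hasDerivAt_id t).mul_const (fderiv ℝ f x h))).sub
      ((hasDerivAt_pow 2 t).const_mul (L / 2 * ‖h‖ ^ 2))
    refine h2.congr_deriv ?_
    push_cast
    ring
  have hanti : AntitoneOn q (Set.Ici 0) := by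
    refine antitoneOn_of_deriv_nonpos (convex_Ici 0)
      (fun t _ => (hqd t).continuousAt.continuousWithinAt)
      (fun t _ => (hqd t).differentiableAt.differentiableWithinAt) fun t ht => ?_
    rw [interior_Ici, Set.mem_Ioi] at ht
    rw [(hqd t).deriv]
    have h3 : (fderiv ℝ f (x + t • h) - fderiv ℝ f x) h ≤ L * ‖h‖ ^ 2 * t := by
      calc (fderiv ℝ f (x + t • h) - fderiv ℝ f x) h
          ≤ ‖(fderiv ℝ f (x + t • h) - fderiv ℝ f x) h‖ := Real.le_norm_self _
        _ ≤ ‖fderiv ℝ f (x + t • h) - fderiv ℝ f x‖ * ‖h‖ := ContinuousLinearMap.le_opNorm _ _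
        _ ≤ L * ‖x + t • h - x‖ * ‖h‖ := by gcongr; exact hf.2 _ _
        _ = L * ‖h‖ ^ 2 * t := by
          rw [add_sub_cancel_left, norm_smul, Real.norm_of_nonneg ht.le]
          ring
    rw [_root_.sub_apply] at h3
    linarith
  have := hanti (Set.self_mem_Ici) (Set.mem_Ici.2 zero_le_one) zero_le_one
  simp only [hq, zero_smul, add_zero, one_smul] at this
  linarith

/-- Duality between smoothness and strong convexity. If `f` is `L`-smooth and `φ` is, on the convex
set `s`, the conjugate of `f` under the pairing `B`, then `φ` is `1 / L`-strongly convex on `s` with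
respect to any function `N` dominated by the norm dual to that of `E`, in the sense that `N x` is a
value of `B x` on the unit ball. -/
lemma SmoothInNorm.strongConvexOnWrt_conjugate {F : Type*} [AddCommGroup F] [Module ℝ F]
    {f : E → ℝ} {L : ℝ} (hf : SmoothInNorm L f) (hL : 0 < L) (B : F →ₗ[ℝ] E →ₗ[ℝ] ℝ) {N : F → ℝ}
    (hN : ∀ x, ∃ h, ‖h‖ ≤ 1 ∧ B x h = N x) {s : Set F} (hs : Convex ℝ s) {φ : F → ℝ}
    (hle : ∀ x ∈ s, ∀ y, B x y - f y ≤ φ x)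
    (hlub : ∀ x ∈ s, ∀ ε > 0, ∃ y, φ x - ε ≤ B x y - f y) :
    StrongConvexOnWrt N s (1 / L) φ := by
  refine ⟨hs, fun x hx y hy a b ha hb hab => le_of_forall_pos_le_add fun ε hε => ?_⟩
  obtain ⟨w, hw⟩ := hlub _ (hs hx hy ha hb hab) ε hε
  obtain ⟨h₀, hh₀, hBh₀⟩ := hN (x - y)
  -- The step maximises `t * N (x - y) - L / 2 * t ^ 2`.
  set t := N (x - y) / L with ht
  set h := t • h₀ with hh
  have hnorm : ‖h‖ ^ 2 ≤ t ^ 2 := by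
    rw [hh, norm_smul, mul_pow, Real.norm_eq_abs, sq_abs]
    exact mul_le_of_le_one_right (sq_nonneg _) (pow_le_one₀ (norm_nonneg _) hh₀)
  have hBh : B x h - B y h = L * t ^ 2 := by
    rw [← LinearMap.sub_apply, ← map_sub, hh, map_smul, hBh₀, smul_eq_mul, ht]
    field_simp
  have hx1 := hle x hx (w + b • h)
  have hy1 := hle y hy (w + (-a) • h)
  have hx2 := hf.le_add_fderiv w (b • h)
  have hy2 := hf.le_add_fderiv w ((-a) • h)
  simp only [map_add, map_smul, smul_eq_mul, LinearMap.add_apply, LinearMap.smul_apply, norm_smul,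
    mul_pow, Real.norm_eq_abs, sq_abs] at hx1 hy1 hx2 hy2 hw
  have hx3 := mul_le_mul_of_nonneg_left (hx1.trans' (sub_le_sub_left hx2 _)) ha
  have hy3 := mul_le_mul_of_nonneg_left (hy1.trans' (sub_le_sub_left hy2 _)) hb
  have hq : a * b * (L / 2 * ‖h‖ ^ 2) ≤ a * b * (L / 2 * t ^ 2) := by gcongr
  have hm : 1 / L / 2 * N (x - y) ^ 2 = L / 2 * t ^ 2 := by
    rw [ht]
    field_simp
  rw [hm]
  obtain rfl : b = 1 - a := by linarith
  have hBh' : a * (1 - a) * (B x h - B y h) = a * (1 - a) * (L * t ^ 2) := by rw [hBh]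
  linarith

end NormedSpace

/-! ### The mirror map and its conjugate potential -/

namespace Matrix

variable {ι : Type*} [Fintype ι] [DecidableEq ι] {A : Matrix ι ι ℝ}

/-- No continuity is needed to compose functions of a matrix, because its spectrum is finite. -/
lemma cfc_cfc (hA : A.IsHermitian) (g f : ℝ → ℝ) : cfc g (cfc f A) = cfc (fun x => g (f x)) A :=
  (cfc_comp' g f A (A.finite_real_spectrum.image f |>.continuousOn g)
    (A.finite_real_spectrum.continuousOn f) hA).symm

lemma cfc_exp_sub_smul_one (hA : A.IsHermitian) (s : ℝ) :
    cfc Real.exp (A - s • (1 : Matrix ι ι ℝ)) = Real.exp (-s) • cfc Real.exp A := by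
  have h : A - s • (1 : Matrix ι ι ℝ) = cfc (fun x : ℝ => x - s) A := by
    have hc : cfc (fun _ : ℝ => s) A = s • (1 : Matrix ι ι ℝ) := by
      rw [← Algebra.algebraMap_eq_smul_one]
      exact cfc_const s A hA
    calc A - s • (1 : Matrix ι ι ℝ) = cfc (fun x : ℝ => x) A - cfc (fun _ : ℝ => s) A := by
          rw [hA.cfc_id_eq, hc]
      _ = _ := (cfc_sub (fun x : ℝ => x) (fun _ : ℝ => s) A).symm
  rw [h, cfc_cfc hA, ← cfc_smul (Real.exp (-s)) Real.exp A]
  congr 1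
  ext x
  rw [smul_eq_mul, ← Real.exp_add]
  ring_nf

lemma cfc_log_cfc_exp (hA : A.IsHermitian) : cfc Real.log (cfc Real.exp A) = A := by
  rw [cfc_cfc hA]
  simp_rw [Real.log_exp]
  exact cfc_id' ℝ A hA

lemma posSemidef_cfc (hA : A.IsHermitian) {f : ℝ → ℝ} (hf : ∀ x, 0 ≤ f x) :
    (cfc f A).PosSemidef := by
  rw [hA.cfc_eq_conj_diagonal]
  exact (PosSemidef.diagonal fun i => hf _).mul_mul_conjTranspose_same _

end Matrix

namespace SymMat

variable {n : ℕ} {K : ℝ}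

lemma isHermitian (X : SymMat n) : (X : Matrix (Fin n) (Fin n) ℝ).IsHermitian := X.2

/-- The functional calculus as a map into symmetric matrices. -/
noncomputable def map (f : ℝ → ℝ) (X : SymMat n) : SymMat n :=
  ⟨cfc f (X : Matrix (Fin n) (Fin n) ℝ), Matrix.IsHermitian.cfc_isHermitian f _⟩

/-- The identity matrix as a symmetric matrix. -/
def one (n : ℕ) : SymMat n :=
  ⟨1, (IsSelfAdjoint.one _ : IsSelfAdjoint (1 : Matrix (Fin n) (Fin n) ℝ))⟩

lemma coe_one : (one n : Matrix (Fin n) (Fin n) ℝ) = 1 := rfl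

/-- The translate `Y - s • 1` by a multiple of the identity matrix. -/
noncomputable def shift (Y : SymMat n) (s : ℝ) : SymMat n :=
  Y - s • one n

/-- The inner product `A • B` as a bilinear form on symmetric matrices. -/
noncomputable def pairing (n : ℕ) : SymMat n →ₗ[ℝ] SymMat n →ₗ[ℝ] ℝ :=
  LinearMap.mk₂ ℝ (fun X Y => frobInner (X : Matrix (Fin n) (Fin n) ℝ) Y)
    (fun X X' Y => by simp [frobInner, add_mul])
    (fun c X Y => by simp [frobInner])
    (fun X Y Y' => by simp [frobInner, mul_add])
    (fun c X Y => by simp [frobInner])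

lemma pairing_apply (X Y : SymMat n) :
    pairing n X Y = frobInner (X : Matrix (Fin n) (Fin n) ℝ) Y := rfl

lemma pairing_eq_trace (X Y : SymMat n) :
    pairing n X Y = ((X : Matrix (Fin n) (Fin n) ℝ) * (Y : Matrix (Fin n) (Fin n) ℝ)).trace := by
  have h : (X : Matrix (Fin n) (Fin n) ℝ).transpose = X := X.isHermitian
  rw [pairing_apply, frobInner, h]

lemma pairing_shift (X Y : SymMat n) (s : ℝ) :
    pairing n X (shift Y s) = pairing n X Y - s * (X : Matrix (Fin n) (Fin n) ℝ).trace := by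
  rw [shift, map_sub, map_smul, smul_eq_mul, pairing_eq_trace X (one n), coe_one, mul_one]

lemma mirrorMap_eq (X : SymMat n) :
    mirrorMap X = pairing n X (map Real.log X) - (X : Matrix (Fin n) (Fin n) ℝ).trace := rfl

lemma traceExp_nonneg (Y : SymMat n) : 0 ≤ traceExp Y := by
  rw [traceExp, Y.isHermitian.trace_cfc]
  exact Finset.sum_nonneg fun i _ => (Real.exp_pos _).le

lemma traceExp_shift (Y : SymMat n) (s : ℝ) :
    traceExp (shift Y s) = Real.exp (-s) * traceExp Y := by
  have h := Matrix.cfc_exp_sub_smul_one Y.isHermitian s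
  rw [traceExp, traceExp, ← smul_eq_mul, ← Matrix.trace_smul, ← h]
  rfl

/-- Klein's inequality: `traceExp` dominates the conjugate of the mirror map. -/
lemma pairing_le_mirrorMap_add_traceExp {X : SymMat n}
    (hX : (X : Matrix (Fin n) (Fin n) ℝ).PosSemidef) (Y : SymMat n) :
    pairing n X Y ≤ mirrorMap X + traceExp Y := by
  rw [mirrorMap_eq, pairing_eq_trace, pairing_eq_trace]
  exact X.isHermitian.trace_mul_le_entropy_add_trace_exp hX.eigenvalues_nonneg Y.isHermitian

/-- Klein's inequality is an equality at `X = exp Y`. -/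
lemma mirrorMap_map_exp (Y : SymMat n) :
    mirrorMap (map Real.exp Y) = pairing n (map Real.exp Y) Y - traceExp Y := by
  have h : map Real.log (map Real.exp Y) = Y :=
    Subtype.ext (Matrix.cfc_log_cfc_exp Y.isHermitian)
  rw [mirrorMap_eq, h]
  rfl

lemma posSemidef_map_exp (Y : SymMat n) :
    (map Real.exp Y : Matrix (Fin n) (Fin n) ℝ).PosSemidef :=
  Matrix.posSemidef_cfc Y.isHermitian fun x => (Real.exp_pos x).le

/-- `log Tr exp` is `1`-Lipschitz in the operator norm: Klein's inequality at `exp Y` and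
`Z + ‖Y - Z‖ • 1`, where the first-order term is nonnegative. -/
lemma traceExp_le_exp_norm_mul (Y Z : SymMat n) :
    traceExp Y ≤ Real.exp ‖Y - Z‖ * traceExp Z := by
  have h1 := pairing_le_mirrorMap_add_traceExp (posSemidef_map_exp Y) (shift Z (-‖Y - Z‖))
  rw [pairing_shift, mirrorMap_map_exp, traceExp_shift, neg_neg] at h1
  have h2 : |pairing n (map Real.exp Y) (Y - Z)| ≤ traceExp Y * ‖Y - Z‖ := by
    rw [pairing_eq_trace]
    exact Y.isHermitian.abs_trace_cfc_mul_le (Y - Z).isHermitian fun x => (Real.exp_pos x).le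
  have h3 : (map Real.exp Y : Matrix (Fin n) (Fin n) ℝ).trace = traceExp Y := rfl
  rw [h3] at h1
  rw [map_sub] at h2
  have := le_of_abs_le h2
  linarith

/-- The amount `max 0 (log (Tr exp Y / 2K))` by which `Y` has to be lowered for `Tr exp` not to
exceed `2K`. For `n = 0` the trace vanishes and `Real.log 0 = 0` gives the correct value `0`. -/
noncomputable def excess (K : ℝ) (Y : SymMat n) : ℝ :=
  max 0 (Real.log (traceExp Y / (2 * K)))

lemma excess_nonneg (K : ℝ) (Y : SymMat n) : 0 ≤ excess K Y := le_max_left _ _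

lemma excess_of_le (hK : 0 < K) {Y : SymMat n} (h : traceExp Y ≤ 2 * K) : excess K Y = 0 :=
  max_eq_left (Real.log_nonpos (div_nonneg (traceExp_nonneg Y) (by positivity))
    ((div_le_one (by positivity)).2 h))

lemma excess_of_gt (hK : 0 < K) {Y : SymMat n} (h : 2 * K < traceExp Y) :
    excess K Y = Real.log (traceExp Y) - Real.log (2 * K) := by
  rw [excess, Real.log_div (by linarith) (by positivity), max_eq_right]
  exact sub_nonneg.2 (Real.log_le_log (by positivity) h.le)

lemma traceExp_shift_excess_of_gt (hK : 0 < K) {Y : SymMat n} (h : 2 * K < traceExp Y) :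
    traceExp (shift Y (excess K Y)) = 2 * K := by
  have hpos : 0 < traceExp Y := by linarith
  rw [traceExp_shift, excess_of_gt hK h, neg_sub, Real.exp_sub, Real.exp_log (by positivity),
    Real.exp_log hpos, div_mul_cancel₀ _ hpos.ne']

lemma shift_zero (Y : SymMat n) : shift Y 0 = Y := by simp [shift]

lemma traceExp_shift_excess_le (hK : 0 < K) (Y : SymMat n) :
    traceExp (shift Y (excess K Y)) ≤ 2 * K := by
  rcases le_or_gt (traceExp Y) (2 * K) with h | h
  · rwa [excess_of_le hK h, shift_zero]
  · exact (traceExp_shift_excess_of_gt hK h).le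

lemma excess_mul_traceExp_shift (hK : 0 < K) (Y : SymMat n) :
    excess K Y * traceExp (shift Y (excess K Y)) = 2 * K * excess K Y := by
  rcases le_or_gt (traceExp Y) (2 * K) with h | h
  · simp [excess_of_le hK h]
  · rw [traceExp_shift_excess_of_gt hK h, mul_comm]

/-- Both branches of the potential in one formula. -/
lemma piecewisePotential_eq (hK : 0 < K) (Y : SymMat n) :
    piecewisePotential K Y = traceExp (shift Y (excess K Y)) + 2 * K * excess K Y := by
  rw [piecewisePotential]
  split_ifs with h
  · simp [excess_of_le hK h, shift_zero]
  · rw [traceExp_shift_excess_of_gt hK (not_le.1 h), excess_of_gt hK (not_le.1 h)]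
    ring

lemma piecewisePotential_le_traceExp (hK : 0 < K) (Y : SymMat n) :
    piecewisePotential K Y ≤ traceExp Y := by
  rw [piecewisePotential]
  split_ifs with h
  · exact le_rfl
  · have hpos : 0 < traceExp Y := by linarith
    have hlog := Real.log_le_sub_one_of_pos (div_pos hpos (by positivity : 0 < 2 * K))
    rw [Real.log_div hpos.ne' (by positivity)] at hlog
    have := mul_le_mul_of_nonneg_left hlog (by positivity : 0 ≤ 2 * K)
    rw [mul_sub, mul_sub, mul_div_cancel₀ _ (by positivity)] at this
    linarith

lemma excess_le_add_norm (hK : 0 < K) (Y Z : SymMat n) :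
    excess K Y ≤ excess K Z + ‖Y - Z‖ := by
  rcases le_or_gt (traceExp Y) (2 * K) with h | h
  · rw [excess_of_le hK h]
    exact add_nonneg (excess_nonneg K Z) (norm_nonneg _)
  · have hY : 0 < traceExp Y := by linarith
    have hYZ := traceExp_le_exp_norm_mul Y Z
    have hZ : 0 < traceExp Z := pos_of_mul_pos_right (hY.trans_le hYZ) (Real.exp_pos _).le
    have h1 := Real.log_le_log hY hYZ
    rw [Real.log_mul (Real.exp_pos _).ne' hZ.ne', Real.log_exp] at h1
    have h2 : Real.log (traceExp Z) - Real.log (2 * K) ≤ excess K Z := by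
      rw [← Real.log_div hZ.ne' (by positivity)]
      exact le_max_right _ _
    rw [excess_of_gt hK h]
    linarith

lemma abs_excess_sub_le (hK : 0 < K) (Y Z : SymMat n) :
    |excess K Y - excess K Z| ≤ ‖Y - Z‖ := by
  have h1 := excess_le_add_norm hK Y Z
  have h2 := excess_le_add_norm hK Z Y
  rw [norm_sub_rev Z Y] at h2
  exact abs_sub_le_iff.2 ⟨by linarith, by linarith⟩

lemma norm_shift_sub_shift_le (Y Z : SymMat n) (s t : ℝ) :
    ‖shift Y s - shift Z t‖ ≤ ‖Y - Z‖ + |s - t| := by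
  have h1 : ‖one n‖ ≤ 1 := by
    change ‖(1 : Matrix (Fin n) (Fin n) ℝ)‖ ≤ 1
    rw [← Matrix.diagonal_one, Matrix.l2_opNorm_diagonal, pi_norm_le_iff_of_nonneg zero_le_one]
    simp
  have h2 : shift Y s - shift Z t = (Y - Z) - (s - t) • one n := by
    rw [shift, shift]
    module
  rw [h2]
  refine (norm_sub_le _ _).trans (add_le_add le_rfl ?_)
  rw [norm_smul, Real.norm_eq_abs]
  exact mul_le_of_le_one_right (abs_nonneg _) h1

/-- The matrix representing the gradient of the potential: `exp Y`, scaled down to trace `2K` where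
its trace is larger. -/
noncomputable def gradient (K : ℝ) (Y : SymMat n) : SymMat n :=
  map Real.exp (shift Y (excess K Y))

/-- One half of the constant `4K` comes from `Y - Z` itself, the other from the difference of
the multiples of the identity by which `Y` and `Z` are lowered. -/
lemma abs_pairing_gradient_sub_le (hK : 0 < K) (Y Z C : SymMat n) :
    |pairing n (gradient K Y - gradient K Z) C| ≤ 4 * K * ‖Y - Z‖ * ‖C‖ := by
  have h1 := Matrix.abs_trace_cfc_exp_sub_mul_le (shift Y (excess K Y)).isHermitian
    (shift Z (excess K Z)).isHermitian (C : Matrix (Fin n) (Fin n) ℝ)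
  have h2 : (traceExp (shift Y (excess K Y)) + traceExp (shift Z (excess K Z))) / 2 ≤ 2 * K := by
    linarith [traceExp_shift_excess_le hK Y, traceExp_shift_excess_le hK Z]
  have h3 : ‖shift Y (excess K Y) - shift Z (excess K Z)‖ ≤ 2 * ‖Y - Z‖ := by
    linarith [norm_shift_sub_shift_le Y Z (excess K Y) (excess K Z), abs_excess_sub_le hK Y Z]
  rw [pairing_eq_trace]
  calc _ ≤ (traceExp (shift Y (excess K Y)) + traceExp (shift Z (excess K Z))) / 2 *
        (‖shift Y (excess K Y) - shift Z (excess K Z)‖ * ‖C‖) := h1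
    _ ≤ 2 * K * (2 * ‖Y - Z‖ * ‖C‖) := by gcongr
    _ = _ := by ring

/-- Fenchel–Young inequality between the mirror map and the potential. The trace bound `2K` enters
as the slope of the potential along multiples of the identity. -/
lemma pairing_sub_piecewisePotential_le (hK : 0 < K) {X : SymMat n}
    (hX : X ∈ psdTraceLE n (2 * K)) (Y : SymMat n) :
    pairing n X Y - piecewisePotential K Y ≤ mirrorMap X := by
  have h1 := pairing_le_mirrorMap_add_traceExp hX.1 (shift Y (excess K Y))
  have h2 := mul_le_mul_of_nonneg_left hX.2 (excess_nonneg K Y)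
  rw [pairing_shift] at h1
  rw [piecewisePotential_eq hK]
  linarith

/-- Equality in the Fenchel–Young inequality at the gradient. -/
lemma mirrorMap_gradient (hK : 0 < K) (Y : SymMat n) :
    mirrorMap (gradient K Y) = pairing n (gradient K Y) Y - piecewisePotential K Y := by
  have h : (gradient K Y : Matrix (Fin n) (Fin n) ℝ).trace = traceExp (shift Y (excess K Y)) := rfl
  rw [piecewisePotential_eq hK, gradient, mirrorMap_map_exp, pairing_shift, ← gradient, h,
    excess_mul_traceExp_shift hK]
  ring

lemma piecewisePotential_add_pairing_le (hK : 0 < K) (Y Z : SymMat n) :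
    piecewisePotential K Y + pairing n (gradient K Y) (Z - Y) ≤ piecewisePotential K Z := by
  have h := pairing_sub_piecewisePotential_le hK
    (X := gradient K Y) ⟨posSemidef_map_exp _, traceExp_shift_excess_le hK Y⟩ Z
  rw [mirrorMap_gradient hK] at h
  rw [map_sub]
  linarith

theorem smoothInNorm_piecewisePotential (hK : 0 < K) :
    SmoothInNorm (4 * K) (piecewisePotential K : SymMat n → ℝ) := by
  refine smoothInNorm_of_subgradient
    (G := fun Y => LinearMap.toContinuousLinearMap (pairing n (gradient K Y)))
    (fun Y Z => piecewisePotential_add_pairing_le hK Y Z) fun Y Z => ?_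
  rw [← map_sub, ← map_sub]
  exact ContinuousLinearMap.opNorm_le_bound _ (by positivity)
    fun C => abs_pairing_gradient_sub_le hK Y Z C

/-- Approximate maximisers in the conjugate: `log (X + δ)`, which avoids the singularity of the
logarithm at zero eigenvalues of `X`. -/
lemma exists_mirrorMap_sub_le (hK : 0 < K) {X : SymMat n}
    (hX : (X : Matrix (Fin n) (Fin n) ℝ).PosSemidef) {ε : ℝ} (hε : 0 < ε) :
    ∃ Y : SymMat n, mirrorMap X - ε ≤ pairing n X Y - piecewisePotential K Y := by
  set δ : ℝ := ε / (n + 1) with hδ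
  have hδ0 : 0 < δ := by positivity
  have hnδ : n * δ ≤ ε := by
    rw [hδ, mul_div_assoc', div_le_iff₀ (by positivity)]
    nlinarith
  refine ⟨map (fun x => Real.log (x + δ)) X, ?_⟩
  have hx := hX.eigenvalues_nonneg
  have hH : hX.1 = X.isHermitian := rfl
  rw [hH] at hx
  set x := X.isHermitian.eigenvalues
  have htr : (X : Matrix (Fin n) (Fin n) ℝ).trace = ∑ i, x i := by
    have h := X.isHermitian.trace_cfc fun x => x
    rwa [X.isHermitian.cfc_id_eq] at h
  have hexp : traceExp (map (fun x => Real.log (x + δ)) X) = ∑ i, x i + n * δ := by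
    rw [traceExp, map, Matrix.cfc_cfc X.isHermitian, X.isHermitian.trace_cfc]
    calc _ = ∑ i, (x i + δ) :=
          Finset.sum_congr rfl fun i _ => Real.exp_log (add_pos_of_nonneg_of_pos (hx i) hδ0)
      _ = _ := by simp [Finset.sum_add_distrib]
  have hmono : ∑ i, x i * Real.log (x i) ≤ ∑ i, x i * Real.log (x i + δ) := by
    refine Finset.sum_le_sum fun i _ => ?_
    rcases (hx i).eq_or_lt with h | h
    · simp [← h]
    · exact mul_le_mul_of_nonneg_left (Real.log_le_log h (by linarith)) h.le
  have h1 := piecewisePotential_le_traceExp hK (map (fun x => Real.log (x + δ)) X)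
  rw [hexp] at h1
  rw [mirrorMap_eq, htr, pairing_eq_trace, pairing_eq_trace, map, map,
    X.isHermitian.trace_mul_cfc, X.isHermitian.trace_mul_cfc]
  rw [map] at h1
  linarith

lemma psdTraceLE_subset (hK : 0 < K) : psdTraceLE n K ⊆ psdTraceLE n (2 * K) :=
  fun _ hX => ⟨hX.1, hX.2.trans (by linarith)⟩

theorem convex_psdTraceLE (n : ℕ) (K : ℝ) : Convex ℝ (psdTraceLE n K) := by
  intro X hX Y hY a b ha hb hab
  refine ⟨(hX.1.smul ha).add (hY.1.smul hb), ?_⟩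
  have h : ((a • X + b • Y : SymMat n) : Matrix (Fin n) (Fin n) ℝ).trace =
      a * (X : Matrix (Fin n) (Fin n) ℝ).trace + b * (Y : Matrix (Fin n) (Fin n) ℝ).trace := by
    simp
  rw [h]
  calc _ ≤ a * K + b * K :=
        add_le_add (mul_le_mul_of_nonneg_left hX.2 ha) (mul_le_mul_of_nonneg_left hY.2 hb)
    _ = K := by rw [← add_mul, hab, one_mul]

theorem conjugate_piecewisePotential (hK : 0 < K) {X : SymMat n} (hX : X ∈ psdTraceLE n K) :
    conjugate (piecewisePotential K) X = ((mirrorMap X : ℝ) : EReal) := by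
  refine le_antisymm (iSup_le fun Y => ?_) (le_of_forall_lt fun c hc => ?_)
  · exact EReal.coe_le_coe_iff.2
      (pairing_sub_piecewisePotential_le hK (psdTraceLE_subset hK hX) Y)
  · obtain ⟨r, hcr, hr⟩ := EReal.lt_iff_exists_real_btwn.1 hc
    obtain ⟨Y, hY⟩ := exists_mirrorMap_sub_le hK hX.1 (sub_pos.2 (EReal.coe_lt_coe_iff.1 hr))
    rw [sub_sub_cancel] at hY
    exact hcr.trans_le ((EReal.coe_le_coe_iff.2 hY).trans
      (le_iSup (fun Y : SymMat n =>
        ((frobInner (X : Matrix (Fin n) (Fin n) ℝ) Y - piecewisePotential K Y : ℝ) : EReal)) Y))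

theorem strongConvexOnWrt_mirrorMap (hK : 0 < K) :
    StrongConvexOnWrt (fun X : SymMat n => nuclearNorm (X : Matrix (Fin n) (Fin n) ℝ))
      (psdTraceLE n K) (1 / (4 * K)) mirrorMap := by
  refine (smoothInNorm_piecewisePotential hK).strongConvexOnWrt_conjugate (by positivity)
    (pairing n) (fun X => ⟨map (fun x => (SignType.sign x : ℝ)) X, ?_, ?_⟩)
    (convex_psdTraceLE n K)
    (fun X hX Y => pairing_sub_piecewisePotential_le hK (psdTraceLE_subset hK hX) Y)
    (fun X hX ε hε => exists_mirrorMap_sub_le hK hX.1 hε)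
  · exact norm_cfc_sign_le X.isHermitian
  · rw [pairing_eq_trace]
    exact trace_mul_cfc_sign X.isHermitian

end SymMat

theorem mainTheorem5 (n : ℕ) (K : ℝ) (hK : 0 < K) :
    StrongConvexOnWrt (fun X : SymMat n => nuclearNorm (X : Matrix (Fin n) (Fin n) ℝ))
        (psdTraceLE n K) (1 / (4 * K)) mirrorMap ∧
      SmoothInNorm (4 * K) (piecewisePotential K : SymMat n → ℝ) ∧
      ∀ X ∈ psdTraceLE n K,
        conjugate (piecewisePotential K) X = ((mirrorMap X : ℝ) : EReal) :=
  ⟨SymMat.strongConvexOnWrt_mirrorMap hK, SymMat.smoothInNorm_piecewisePotential hK,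
    fun _ hX => SymMat.conjugate_piecewisePotential hK hX⟩
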